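/- Let $0\le k<n$ be integers and $0<\delta<1$. For $x\in\mathbb{R}^n$ and $r>0$ let $S^j_k(x,r)$, $j=1,\dots,N=\binom nk 2^{n-k}$, be the $k$-dimensional faces of the cube $x+[-r,r]^n$, and let $S^j_{k,\delta}(x,r)$ be the open $\delta$-neighbourhood of $S^j_k(x,r)$ for the distance induced by the supremum norm. For $f\in L^1_{\mathrm{loc}}(\mathbb{R}^n)$ put $$\mathbf{M}^k_\delta f(x)=\sup_{r:\mathbb{R}^n\to(\delta,2]}\ \min_{1\le j\le N}\ \frac{1}{\mathcal{L}_n(S^j_{k,\delta}(x,r(x)))}\int_{S^j_{k,\delta}(x,r(x))}|f(y)|\,dy ,$$ where $\mathcal{L}_n$ is Lebesgue measure and the supremum is over arbitrary functions $r:\mathbb{R}^n\to(\delta,2]$. Then there is a constant $C_{n,k}>0$, depending only on $n$ and $k$, such that for all $p\in[1,\infty)$, all $\delta\in(0,1)$ and all $f\in L^p(\mathbb{R}^n)$, the function $\mathbf{M}^k_\delta f$ belongs to $L^p(\mathbb{R}^n)$ and $$\|\mathbf{M}^k_\delta f\|_{L^p(\mathbb{R}^n)}\le C_{n,k}\,\delta^{\frac{k-n}{2np}}\,\|f\|_{L^p(\mathbb{R}^n)}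 .$$ -/

import Mathlib

open MeasureTheory
open scoped ENNReal

noncomputable section

/-- The `k`-faces of an `n`-cube: a `k`-element set `I` of free coordinates, and a sign for each
of the remaining `n - k` coordinates. -/
abbrev FaceIndex (n k : ℕ) : Type :=
  Σ I : {I : Finset (Fin n) // I.card = k}, ({i : Fin n // i ∉ I.1} → ℤˣ)

/-- The closed `k`-face `j` of the `n`-cube `x + [-r, r]^n`. -/
def cubeFace {n k : ℕ} (j : FaceIndex n k) (x : Fin n → ℝ) (r : ℝ) : Set (Fin n → ℝ) :=
  {y | (∀ i ∈ j.1.1, y i ∈ Set.Icc (x i - r) (x i + r)) ∧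
    ∀ i : {i : Fin n // i ∉ j.1.1}, y i.1 = x i.1 + ((j.2 i : ℤ) : ℝ) * r}

/-- The open `δ`-neighbourhood of the `k`-face `j` of `x + [-r, r]^n`. The distance on
`Fin n → ℝ` is the one induced by the supremum norm. -/
def cubeFaceNhd {n k : ℕ} (δ : ℝ) (j : FaceIndex n k) (x : Fin n → ℝ) (r : ℝ) :
    Set (Fin n → ℝ) :=
  Metric.thickening δ (cubeFace j x r)

/-- The mean of `|f|` over the `δ`-neighbourhood of the `k`-face `j` of `x + [-r, r]^n`,
with respect to Lebesgue measure. -/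
def faceAverage {n k : ℕ} {𝕜 : Type*} [RCLike 𝕜] (δ : ℝ) (f : (Fin n → ℝ) → 𝕜)
    (j : FaceIndex n k) (x : Fin n → ℝ) (r : ℝ) : ℝ≥0∞ :=
  (volume (cubeFaceNhd δ j x r))⁻¹ * ∫⁻ y in cubeFaceNhd δ j x r, ‖f y‖ₑ

/-- The minimum over all `k`-faces of the face averages at `x`, for the radius function `r`.
The index type of the faces is finite, and nonempty if `k ≤ n`, so that this infimum is a
minimum. -/
def skeletonAverage {n : ℕ} {𝕜 : Type*} [RCLike 𝕜] (k : ℕ) (δ : ℝ) (r : (Fin n → ℝ) → ℝ)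
    (f : (Fin n → ℝ) → 𝕜) (x : Fin n → ℝ) : ℝ≥0∞ :=
  ⨅ j : FaceIndex n k, faceAverage δ f j x (r x)

/-- The unrestricted `k`-skeleton maximal operator of width `δ`: the supremum of the averages
over all (not necessarily measurable) radius functions with values in `(δ, 2]`. -/
def skeletonMaximal {n : ℕ} {𝕜 : Type*} [RCLike 𝕜] (k : ℕ) (δ : ℝ)
    (f : (Fin n → ℝ) → 𝕜) (x : Fin n → ℝ) : ℝ≥0∞ :=
  ⨆ r : (Fin n → ℝ) → Set.Ioc δ 2, skeletonAverage k δ (fun z => (r z : ℝ)) f x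

end

/-! Rescale by `δ` and replace points by cells of `δ ℤⁿ`. Jensen reduces the bound to means of `‖f‖
^ p`, and a supremum over radii is at most a sum over dyadic ranges `[S, 2S)` of `r / δ`, with the
best integer radius `s z` chosen for each cell `z`. The minimum over faces then permits any choice
of face for each `z`. If the chosen faces cover each lattice point at most `K` times, summing the
means costs `K / S ^ k`; `exists_face_assignment` achieves `K ≲ S ^ (k + (n - k) / (2n))`. The
resulting powers of `S` form a geometric series dominated by `S ~ 2 / δ`.

To choose the faces inside a block of side `S`, first choose one of the two vertices `z ± s z • (1,
…, 1)` so that each vertex serves `O(√S)` centres (`exists_sign_card_fiber_le`). Among coordinate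
`k`-flats through such vertices, some flat always meets few of them
(`exists_flat_section_pow_card_le`); assigning flats greedily (`exists_assignment_card_fiber_le`)
bounds every fibre. -/

/-! ### Greedy assignment and sparse coordinate flats -/

/-- Greedy removal: give the label `i` to an entire small fibre of `φ i`, delete it, and repeat. No
remaining point has that value of `φ i`, so the fibre never grows. -/
theorem exists_assignment_card_fiber_le {α ι β : Type*} [Nonempty ι] [DecidableEq α]
    [DecidableEq ι] [DecidableEq β] (φ : ι → α → β) {T : ℝ} (hT : 0 ≤ T) (X : Finset α)
    (h : ∀ Y ⊆ X, Y.Nonempty → ∃ x ∈ Y, ∃ i,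
      ((Y.filter (fun x' => φ i x' = φ i x)).card : ℝ) ≤ T) :
    ∃ a : α → ι, ∀ i b, ((X.filter (fun x => a x = i ∧ φ i x = b)).card : ℝ) ≤ T := by
  induction X using Finset.strongInduction with
  | H X ih =>
    rcases X.eq_empty_or_nonempty with rfl | hX
    · exact ⟨fun _ => Classical.arbitrary ι, fun i b => by simpa using hT⟩
    obtain ⟨x, hx, i, hi⟩ := h X subset_rfl hX
    set Z := X.filter (fun x' => φ i x' = φ i x) with hZ
    have hxZ : x ∈ Z := by simp [hZ, hx]
    have hss : X \ Z ⊂ X := Finset.sdiff_ssubset (Finset.filter_subset _ _) ⟨x, hxZ⟩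
    obtain ⟨a, ha⟩ := ih (X \ Z) hss (fun Y hY => h Y (hY.trans hss.1))
    refine ⟨fun y => if y ∈ Z then i else a y, fun i₀ b => ?_⟩
    by_cases hib : i₀ = i ∧ b = φ i x
    · obtain ⟨rfl, rfl⟩ := hib
      refine le_trans ?_ hi
      exact_mod_cast Finset.card_le_card (by
        intro y hy
        simp only [Finset.mem_filter, hZ] at hy ⊢
        exact ⟨hy.1, hy.2.2⟩)
    · refine le_trans ?_ (ha i₀ b)
      have : X.filter (fun y => (if y ∈ Z then i else a y) = i₀ ∧ φ i₀ y = b) ⊆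
          (X \ Z).filter (fun y => a y = i₀ ∧ φ i₀ y = b) := by
        intro y hy
        simp only [Finset.mem_filter, Finset.mem_sdiff] at hy ⊢
        obtain ⟨hyX, h1, h2⟩ := hy
        by_cases hyZ : y ∈ Z
        · rw [if_pos hyZ] at h1
          subst h1
          exact absurd ⟨rfl, h2.symm.trans (Finset.mem_filter.1 hyZ).2⟩ hib
        · rw [if_neg hyZ] at h1
          exact ⟨⟨hyX, hyZ⟩, h1, h2⟩
      exact_mod_cast Finset.card_le_card this

/-- Let `T` be the smallest nonempty section and `Nᵢ` the number of values of coordinate `i`. Then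
`Nᵢ * T ≤ |Z|`, while `|Z| ≤ W * ∏ Nᵢ` because the image lies in a box. Multiplying over `I` gives
the bound. -/
theorem exists_hyperplane_section_pow_card_le {n : ℕ} {α : Type*} (Z : Finset α)
    (hZ : Z.Nonempty) (v : α → Fin n → ℤ) {W m : ℕ}
    (hW : ∀ b, (Z.filter (fun x => v x = b)).card ≤ W) (I : Finset (Fin n))
    (hI : I.card = m + 1) (hcon : ∀ x ∈ Z, ∀ y ∈ Z, ∀ i ∉ I, v x i = v y i) :
    ∃ i ∈ I, ∃ x ∈ Z, (Z.filter (fun y => v y i = v x i)).card ^ (m + 1) ≤ W * Z.card ^ m := by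
  classical
  have hIne : I.Nonempty := by rw [← Finset.card_pos]; omega
  obtain ⟨⟨x, i⟩, hxi, hmin⟩ := Finset.exists_min_image (Z ×ˢ I)
    (fun p => (Z.filter (fun y => v y p.2 = v p.1 p.2)).card) (hZ.product hIne)
  rw [Finset.mem_product] at hxi
  refine ⟨i, hxi.2, x, hxi.1, ?_⟩
  simp only at hmin ⊢
  set T := (Z.filter (fun y => v y i = v x i)).card
  have hN : ∀ i' ∈ I, (Z.image (fun y => v y i')).card * T ≤ Z.card := by
    intro i' hi'
    rw [Finset.card_eq_sum_card_image (fun y => v y i') Z, ← smul_eq_mul]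
    refine Finset.card_nsmul_le_sum _ _ _ fun b hb => ?_
    obtain ⟨y, hy, rfl⟩ := Finset.mem_image.1 hb
    exact hmin (y, i') (Finset.mem_product.2 ⟨hy, hi'⟩)
  have hprod : (Z.image v).card ≤ ∏ i' ∈ I, (Z.image (fun y => v y i')).card := by
    have h1 : Z.image v ⊆ Fintype.piFinset (fun i' => Z.image (fun y => v y i')) := by
      intro b hb
      obtain ⟨y, hy, rfl⟩ := Finset.mem_image.1 hb
      exact Fintype.mem_piFinset.2 fun i' => Finset.mem_image_of_mem (fun y => v y i') hy
    refine (Finset.card_le_card h1).trans ?_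
    rw [Fintype.card_piFinset]
    refine le_of_eq (Finset.prod_subset (Finset.subset_univ I) fun i' _ hi' => ?_).symm
    rw [Finset.card_eq_one]
    refine ⟨v x i', ?_⟩
    ext b
    simp only [Finset.mem_image, Finset.mem_singleton]
    constructor
    · rintro ⟨y, hy, rfl⟩
      exact hcon y hy x hxi.1 i' hi'
    · rintro rfl
      exact ⟨x, hxi.1, rfl⟩
  have hcard : Z.card ≤ W * (Z.image v).card := by
    rw [Finset.card_eq_sum_card_image v Z, mul_comm, ← smul_eq_mul]
    exact Finset.sum_le_card_nsmul _ _ _ fun b _ => hW b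
  have hZpos : 0 < Z.card := hZ.card_pos
  refine le_of_mul_le_mul_left (a := Z.card) ?_ hZpos
  calc Z.card * T ^ (m + 1)
      ≤ (W * ∏ i' ∈ I, (Z.image (fun y => v y i')).card) * T ^ (m + 1) := by gcongr; exact hcard.trans (by gcongr)
    _ = W * ∏ i' ∈ I, ((Z.image (fun y => v y i')).card * T) := by
        rw [Finset.prod_mul_distrib, Finset.prod_const, hI, mul_assoc]
    _ ≤ W * ∏ _i' ∈ I, Z.card := by
        gcongr with i' hi'
        exact hN i' hi'
    _ = Z.card * (W * Z.card ^ m) := by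
        rw [Finset.prod_const, hI]; ring

theorem exists_flat_section_pow_card_le {n : ℕ} {α : Type*} (Y : Finset α)
    (hY : Y.Nonempty) (v : α → Fin n → ℤ) {W : ℕ}
    (hW : ∀ b, (Y.filter (fun x => v x = b)).card ≤ W) (d : ℕ) (hd : d ≤ n) :
    ∃ I : Finset (Fin n), I.card + d = n ∧ ∃ x ∈ Y,
      (Y.filter (fun y => ∀ i ∉ I, v y i = v x i)).card ^ n ≤ W ^ d * Y.card ^ (n - d) := by
  classical
  induction d with
  | zero =>
    obtain ⟨x, hx⟩ := hY
    exact ⟨Finset.univ, by simp, x, hx, by simp⟩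
  | succ d ih =>
    obtain ⟨I, hI, x, hx, hle⟩ := ih (by omega)
    obtain ⟨m, hm⟩ : ∃ m, n = m + 1 + d := ⟨n - d - 1, by omega⟩
    set Z := Y.filter (fun y => ∀ i ∉ I, v y i = v x i) with hZ
    obtain ⟨i, hi, y, hy, hT⟩ := exists_hyperplane_section_pow_card_le (m := m) Z
      ⟨x, by simp [hZ, hx]⟩ v (W := W)
      (fun b => (Finset.card_le_card (Finset.filter_subset_filter _
        (Finset.filter_subset _ _))).trans (hW b)) I (by omega)
      (fun a ha b hb j hj => by
        rw [(Finset.mem_filter.1 ha).2 j hj, (Finset.mem_filter.1 hb).2 j hj])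
    have hyY := Finset.mem_filter.1 hy
    refine ⟨I.erase i, by rw [Finset.card_erase_of_mem hi]; omega, y, hyY.1, ?_⟩
    have hset : Y.filter (fun y' => ∀ j ∉ I.erase i, v y' j = v y j) ⊆
        Z.filter (fun y' => v y' i = v y i) := by
      intro y' hy'
      simp only [Finset.mem_filter, Finset.mem_erase, not_and, hZ] at hy' ⊢
      refine ⟨⟨hy'.1, fun j hj => ?_⟩, hy'.2 i (by simp)⟩
      rw [hy'.2 j (fun _ => hj), hyY.2 j hj]
    set T := (Z.filter (fun y' => v y' i = v y i)).card
    refine (Nat.pow_le_pow_left (Finset.card_le_card hset) n).trans ?_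
    -- Comparing `(m + 1)`-th powers lets both inductive estimates enter without roots.
    refine (Nat.pow_le_pow_iff_left (n := m + 1) (by omega)).1 ?_
    have e1 : n - d = m + 1 := by omega
    have e2 : n - (d + 1) = m := by omega
    rw [e1] at hle
    rw [e2]
    calc (T ^ n) ^ (m + 1) = (T ^ (m + 1)) ^ n := by ring
      _ ≤ (W * Z.card ^ m) ^ n := by gcongr
      _ = W ^ n * (Z.card ^ n) ^ m := by ring
      _ ≤ W ^ n * (W ^ d * Y.card ^ (m + 1)) ^ m := by gcongr
      _ = (W ^ (d + 1) * Y.card ^ m) ^ (m + 1) := by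
        have : W ^ n = W ^ (m + 1 + d) := by rw [← hm]
        rw [this]; ring

/-! ### Choosing faces in the integer lattice -/

/-- The integer cube of side `S` with corner `S • q`. -/
noncomputable def latticeBlock {n : ℕ} (S : ℕ) (q : Fin n → ℤ) : Finset (Fin n → ℤ) :=
  Fintype.piFinset fun i => Finset.Ico (q i * S) ((q i + 1) * S)

theorem card_latticeBlock {n : ℕ} (S : ℕ) (q : Fin n → ℤ) :
    (latticeBlock S q).card = S ^ n := by
  have : ∀ i, (q i + 1) * (S : ℤ) - q i * S = S := fun i => by ring
  simp [latticeBlock, Fintype.card_piFinset, this]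

/-- Use the plus vertex unless it is shared by more than `W` centres. The centres sent to `b` by the
minus sign have distinct plus vertices, each with more than `W` centres; these groups are disjoint
and lie on the diagonal through `b`, which has at most `S` points in the block. Hence there are at
most `S / W ≤ W` of them. -/
theorem exists_sign_card_fiber_le {n : ℕ} (hn : 0 < n) (S W : ℕ) (hW : 0 < W) (hSW : S ≤ W ^ 2)
    (q : Fin n → ℤ) (s : (Fin n → ℤ) → ℤ) :
    ∃ σ : (Fin n → ℤ) → ℤˣ, ∀ b : Fin n → ℤ,
      ((latticeBlock S q).filter (fun z => (fun i => z i + (σ z : ℤ) * s z) = b)).card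
        ≤ 2 * W := by
  classical
  set X := latticeBlock S q
  let G : (Fin n → ℤ) → Finset (Fin n → ℤ) := fun c =>
    X.filter (fun z => (fun i => z i + s z) = c)
  let σ : (Fin n → ℤ) → ℤˣ := fun z => if (G (fun i => z i + s z)).card ≤ W then 1 else -1
  refine ⟨σ, fun b => ?_⟩
  let i₀ : Fin n := ⟨0, hn⟩
  let F := X.filter (fun z => W < (G (fun i => z i + s z)).card ∧ (fun i => z i - s z) = b)
  have hline : (X.filter (fun z => ∃ t : ℤ, z = fun i => b i + t)).card ≤ S := by
    have : (Finset.Ico (q i₀ * S) ((q i₀ + 1) * S)).card = S := by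
      have : (q i₀ + 1) * (S : ℤ) - q i₀ * S = S := by ring
      simp [this]
    conv_rhs => rw [← this]
    refine Finset.card_le_card_of_injOn (fun z => z i₀) ?_ ?_
    · intro z hz
      exact Fintype.mem_piFinset.1 (Finset.mem_filter.1 hz).1 i₀
    · intro z hz z' hz' hzz
      obtain ⟨t, rfl⟩ := (Finset.mem_filter.1 hz).2
      obtain ⟨t', rfl⟩ := (Finset.mem_filter.1 hz').2
      have : t = t' := by simpa using hzz
      rw [this]
  have hF : F.card ≤ W := by
    have hdisj : (F : Set (Fin n → ℤ)).PairwiseDisjoint (fun z => G (fun i => z i + s z)) := by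
      intro z hz z' hz' hne
      refine Finset.disjoint_left.2 fun y hy hy' => hne ?_
      have h1 := (Finset.mem_filter.1 hy).2
      have h2 := (Finset.mem_filter.1 hy').2
      have h3 := (Finset.mem_filter.1 hz).2.2
      have h4 := (Finset.mem_filter.1 hz').2.2
      ext i
      have h1 := congrFun h1 i
      have h2 := congrFun h2 i
      have h3 := congrFun h3 i
      have h4 := congrFun h4 i
      omega
    have hsub : F.biUnion (fun z => G (fun i => z i + s z)) ⊆
        X.filter (fun z => ∃ t : ℤ, z = fun i => b i + t) := by
      intro y hy
      obtain ⟨z, hz, hy⟩ := Finset.mem_biUnion.1 hy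
      have h1 := (Finset.mem_filter.1 hy).2
      have h3 := (Finset.mem_filter.1 hz).2.2
      refine Finset.mem_filter.2 ⟨(Finset.mem_filter.1 hy).1, 2 * s z - s y, ?_⟩
      ext i
      have h1 := congrFun h1 i
      have h3 := congrFun h3 i
      omega
    have h1 : F.card * W ≤ S := by
      refine le_trans ?_ ((Finset.card_le_card hsub).trans hline)
      rw [Finset.card_biUnion hdisj, ← smul_eq_mul]
      exact Finset.card_nsmul_le_sum _ _ _ fun z hz => (Finset.mem_filter.1 hz).2.1.le
    refine le_of_mul_le_mul_right (a := W) ?_ hW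
    rw [← sq]
    exact h1.trans hSW
  by_cases hb : (G b).card ≤ W
  · have hsub : X.filter (fun z => (fun i => z i + (σ z : ℤ) * s z) = b) ⊆ G b ∪ F := by
      intro z hz
      obtain ⟨hzX, hz⟩ := Finset.mem_filter.1 hz
      rw [Finset.mem_union]
      by_cases hl : (G (fun i => z i + s z)).card ≤ W
      · left
        have : σ z = 1 := if_pos hl
        exact Finset.mem_filter.2 ⟨hzX, by simpa [this] using hz⟩
      · right
        have : σ z = -1 := if_neg hl
        refine Finset.mem_filter.2 ⟨hzX, not_le.1 hl, ?_⟩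
        simpa [this, sub_eq_add_neg] using hz
    have := (Finset.card_le_card hsub).trans (Finset.card_union_le _ _)
    omega
  · have hsub : X.filter (fun z => (fun i => z i + (σ z : ℤ) * s z) = b) ⊆ F := by
      intro z hz
      obtain ⟨hzX, hz⟩ := Finset.mem_filter.1 hz
      by_cases hl : (G (fun i => z i + s z)).card ≤ W
      · have : σ z = 1 := if_pos hl
        have hz' : (fun i => z i + s z) = b := by simpa [this] using hz
        rw [hz'] at hl
        exact absurd hl hb
      · have : σ z = -1 := if_neg hl
        refine Finset.mem_filter.2 ⟨hzX, not_le.1 hl, ?_⟩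
        simpa [this, sub_eq_add_neg] using hz
    have := Finset.card_le_card hsub
    omega

theorem exists_face_assignment_of_block {n k : ℕ} (hkn : k < n) (S : ℕ) (hS : 0 < S)
    (q : Fin n → ℤ) (s : (Fin n → ℤ) → ℤ) :
    ∃ (a : (Fin n → ℤ) → {I : Finset (Fin n) // I.card = k}) (σ : (Fin n → ℤ) → ℤˣ),
      ∀ (I : {I : Finset (Fin n) // I.card = k}) (b : Fin n → ℤ),
      (((latticeBlock S q).filter (fun z => a z = I ∧
        ∀ i ∉ I.1, z i + (σ z : ℤ) * s z = b i)).card : ℝ) ≤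
        4 * (S : ℝ) ^ ((k : ℝ) + ((n : ℝ) - k) / (2 * n)) := by
  classical
  have hn : 0 < n := by omega
  have hS1 : (1 : ℝ) ≤ S := by exact_mod_cast hS
  have hsq : 1 ≤ Real.sqrt S := Real.one_le_sqrt.2 hS1
  -- `W = ⌈√S⌉` balances the two fibre bounds `W` and `S / W`.
  obtain ⟨W, hW, hSW, hW2⟩ : ∃ W : ℕ, 0 < W ∧ S ≤ W ^ 2 ∧ (W : ℝ) ≤ 2 * Real.sqrt S := by
    refine ⟨⌈Real.sqrt S⌉₊, Nat.ceil_pos.2 (by linarith), ?_, ?_⟩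
    · have h1 := Nat.le_ceil (Real.sqrt S)
      have : (S : ℝ) ≤ (⌈Real.sqrt S⌉₊ : ℝ) ^ 2 := by
        calc (S : ℝ) = Real.sqrt S ^ 2 := (Real.sq_sqrt (by positivity)).symm
          _ ≤ _ := by gcongr
      exact_mod_cast this
    · have := Nat.ceil_lt_add_one (Real.sqrt_nonneg S)
      linarith
  obtain ⟨σ, hσ⟩ := exists_sign_card_fiber_le hn S W hW hSW q s
  have : Nonempty {I : Finset (Fin n) // I.card = k} := by
    obtain ⟨t, -, ht⟩ := Finset.exists_subset_card_eq
      (s := (Finset.univ : Finset (Fin n))) (n := k) (by simpa using hkn.le)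
    exact ⟨⟨t, ht⟩⟩
  -- Zeroing the free coordinates makes `φ I z` encode the `I`-flat through the chosen vertex.
  let φ : {I : Finset (Fin n) // I.card = k} → (Fin n → ℤ) → Fin n → ℤ := fun I z i =>
    if i ∈ I.1 then 0 else z i + (σ z : ℤ) * s z
  have hφ : ∀ I z (b : Fin n → ℤ), φ I z = (fun i => if i ∈ I.1 then 0 else b i) ↔
      ∀ i ∉ I.1, z i + (σ z : ℤ) * s z = b i := by
    intro I z b
    constructor
    · intro h i hi
      simpa [φ, hi] using congrFun h i
    · intro h
      ext i
      by_cases hi : i ∈ I.1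
      · simp [φ, hi]
      · simpa [φ, hi] using h i hi
  obtain ⟨a, ha⟩ := exists_assignment_card_fiber_le φ
    (T := 4 * (S : ℝ) ^ ((k : ℝ) + ((n : ℝ) - k) / (2 * n))) (by positivity) (latticeBlock S q)
    (by
      intro Y hYX hY
      obtain ⟨I, hI, x, hx, hle⟩ := exists_flat_section_pow_card_le Y hY
        (fun z i => z i + (σ z : ℤ) * s z) (W := 2 * W)
        (fun b => (Finset.card_le_card (Finset.filter_subset_filter _ hYX)).trans (hσ b))
        (n - k) (by omega)
      refine ⟨x, hx, ⟨I, by omega⟩, ?_⟩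
      have hset : Y.filter (fun x' => φ ⟨I, by omega⟩ x' = φ ⟨I, by omega⟩ x) =
          Y.filter (fun y => ∀ i ∉ I, y i + (σ y : ℤ) * s y = x i + (σ x : ℤ) * s x) := by
        refine Finset.filter_congr fun y _ => ?_
        exact hφ ⟨I, by omega⟩ y (fun i => x i + (σ x : ℤ) * s x)
      rw [hset]
      set c := (Y.filter (fun y => ∀ i ∉ I,
        y i + (σ y : ℤ) * s y = x i + (σ x : ℤ) * s x)).card
      have hYc : Y.card ≤ S ^ n := (Finset.card_le_card hYX).trans (card_latticeBlock S q).le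
      have e : n - (n - k) = k := by omega
      rw [e] at hle
      refine le_of_pow_le_pow_left₀ hn.ne' (by positivity) ?_
      calc (c : ℝ) ^ n ≤ (2 * (W : ℝ)) ^ (n - k) * (Y.card : ℝ) ^ k := by exact_mod_cast hle
        _ ≤ (4 * Real.sqrt S) ^ (n - k) * ((S : ℝ) ^ n) ^ k := by
            have h1 : 2 * (W : ℝ) ≤ 4 * Real.sqrt S := by linarith
            have h2 : (Y.card : ℝ) ≤ (S : ℝ) ^ n := by exact_mod_cast hYc
            exact mul_le_mul (pow_le_pow_left₀ (by positivity) h1 _)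
              (pow_le_pow_left₀ (by positivity) h2 _) (by positivity) (by positivity)
        _ ≤ 4 ^ n * (Real.sqrt S ^ (n - k) * ((S : ℝ) ^ n) ^ k) := by
            rw [mul_pow, mul_assoc]
            gcongr
            · norm_num
            · omega
        _ = (4 * (S : ℝ) ^ ((k : ℝ) + ((n : ℝ) - k) / (2 * n))) ^ n := by
            rw [mul_pow]
            congr 1
            have hS0 : (0 : ℝ) < S := by linarith
            have hn0 : (n : ℝ) ≠ 0 := by exact_mod_cast hn.ne'
            rw [Real.sqrt_eq_rpow, ← Real.rpow_natCast, ← Real.rpow_natCast, ← Real.rpow_natCast,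
              ← Real.rpow_natCast, ← Real.rpow_mul hS0.le, ← Real.rpow_mul hS0.le,
              ← Real.rpow_mul hS0.le, ← Real.rpow_add hS0, Nat.cast_sub hkn.le]
            congr 1
            field_simp
            ring)
  refine ⟨a, σ, fun I b => ?_⟩
  have := ha I (fun i => if i ∈ I.1 then 0 else b i)
  simpa only [hφ] using this

/-- The lattice point `w` lies within distance `3` of the `k`-face `j` of the integer cube with
centre `z` and radius `s`. -/
def NearLatticeFace {n k : ℕ} (j : FaceIndex n k) (z : Fin n → ℤ) (s : ℤ) (w : Fin n → ℤ) :
    Prop :=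
  (∀ i ∈ j.1.1, |w i - z i| ≤ s + 3) ∧
    ∀ i : {i : Fin n // i ∉ j.1.1}, |w i.1 - z i.1 - (j.2 i : ℤ) * s| ≤ 3

theorem exists_face_assignment {n k : ℕ} (hkn : k < n) (S : ℕ) (hS : 0 < S)
    (s : (Fin n → ℤ) → ℤ) (hs : ∀ z, S ≤ s z ∧ s z ≤ 2 * S) :
    ∃ j : (Fin n → ℤ) → FaceIndex n k, ∀ w, ∃ A : Finset (Fin n → ℤ),
      (∀ z, NearLatticeFace (j z) z (s z) w → z ∈ A) ∧
      (A.card : ℝ) ≤ (11 ^ n * 7 ^ n * n.choose k * 4) *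
        (S : ℝ) ^ ((k : ℝ) + ((n : ℝ) - k) / (2 * n)) := by
  classical
  choose a σ h using fun q => exists_face_assignment_of_block hkn S hS q s
  let Q : (Fin n → ℤ) → (Fin n → ℤ) := fun z i => z i / S
  refine ⟨fun z => ⟨a (Q z) z, fun _ => σ (Q z) z⟩, fun w => ?_⟩
  -- Sources of faces near `w`: the block of the centre (11 choices per coordinate, as `s z + 3 ≤ 2S
  -- + 3 ≤ 5S`), the offset of the flat from `w` (7 per coordinate), and the free set `I`.
  let P : Finset (((Fin n → ℤ) × (Fin n → ℤ)) × {I : Finset (Fin n) // I.card = k}) :=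
    ((Fintype.piFinset fun i => Finset.Icc (Q w i - 5) (Q w i + 5)) ×ˢ
      (Fintype.piFinset fun _ => Finset.Icc (-3) 3)) ×ˢ Finset.univ
  have hS0 : (0 : ℤ) < S := by exact_mod_cast hS
  refine ⟨P.biUnion fun p => (latticeBlock S p.1.1).filter (fun z => a p.1.1 z = p.2 ∧
    ∀ i ∉ p.2.1, z i + (σ p.1.1 z : ℤ) * s z = w i + p.1.2 i), ?_, ?_⟩
  · rintro z ⟨h1, h2⟩
    simp only at h1 h2
    obtain ⟨hs1, hs2⟩ := hs z
    have hloc : ∀ i, |w i - z i| ≤ s z + 3 := by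
      intro i
      by_cases hi : i ∈ (a (Q z) z).1
      · exact h1 i hi
      · have h3 := h2 ⟨i, hi⟩
        simp only at h3
        rcases Int.units_eq_one_or (σ (Q z) z) with hu | hu <;> rw [hu] at h3 <;>
          simp only [Units.val_one, Units.val_neg, abs_le] at h3 ⊢ <;>
          constructor <;> linarith [h3.1, h3.2]
    -- Offsets in free coordinates are irrelevant; `0` just keeps them in range.
    refine Finset.mem_biUnion.2 ⟨((Q z, fun i => if i ∈ (a (Q z) z).1 then 0 else
      z i + (σ (Q z) z : ℤ) * s z - w i), a (Q z) z), ?_, ?_⟩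
    · refine Finset.mem_product.2 ⟨Finset.mem_product.2 ⟨?_, ?_⟩, Finset.mem_univ _⟩
      · refine Fintype.mem_piFinset.2 fun i => Finset.mem_Icc.2 ?_
        have h3 := abs_le.1 (hloc i)
        constructor
        · have : (w i + (-5) * S) / S ≤ z i / S := Int.ediv_le_ediv hS0 (by linarith)
          rw [Int.add_mul_ediv_right _ _ hS0.ne'] at this
          simp only [Q]; linarith
        · have : z i / S ≤ (w i + 5 * S) / S := Int.ediv_le_ediv hS0 (by linarith)
          rwa [Int.add_mul_ediv_right _ _ hS0.ne'] at this
      · refine Fintype.mem_piFinset.2 fun i => Finset.mem_Icc.2 ?_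
        by_cases hi : i ∈ (a (Q z) z).1
        · simp [hi]
        · have h3 := abs_le.1 (h2 ⟨i, hi⟩)
          simp only [hi, if_false] at h3 ⊢
          constructor <;> linarith [h3.1, h3.2]
    · refine Finset.mem_filter.2 ⟨Fintype.mem_piFinset.2 fun i => Finset.mem_Ico.2 ?_, rfl, ?_⟩
      · refine ⟨Int.ediv_mul_le _ hS0.ne', Int.lt_ediv_add_one_mul_self _ hS0⟩
      · intro i hi
        simp only at hi
        simp [hi]
  · have hP : (P.card : ℝ) = 11 ^ n * 7 ^ n * n.choose k := by
      have e : ∀ i, Q w i + 5 + 1 - (Q w i - 5) = 11 := fun i => by ring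
      have : P.card = 11 ^ n * 7 ^ n * n.choose k := by
        simp only [P, Finset.card_product, Fintype.card_piFinset, Int.card_Icc, e]
        simp [Fintype.card_finset_len]
      rw [this]; push_cast; ring
    rw [mul_assoc _ (4 : ℝ), ← hP]
    calc _ ≤ ((∑ p ∈ P, _ : ℕ) : ℝ) := by exact_mod_cast Finset.card_biUnion_le
      _ = ∑ p ∈ P, _ := by push_cast; rfl
      _ ≤ P.card • (4 * (S : ℝ) ^ ((k : ℝ) + ((n : ℝ) - k) / (2 * n))) :=
          Finset.sum_le_card_nsmul _ _ _ fun p _ => h p.1.1 p.2 (fun i => w i + p.1.2 i)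
      _ = _ := by rw [nsmul_eq_mul]

/-! ### Face neighbourhoods and measurability of the maximal function -/

theorem mem_cubeFaceNhd_iff {n k : ℕ} {δ r : ℝ} (hδ : 0 < δ) (hr : 0 ≤ r) (j : FaceIndex n k)
    (x y : Fin n → ℝ) :
    y ∈ cubeFaceNhd δ j x r ↔ (∀ i ∈ j.1.1, |y i - x i| < r + δ) ∧
      ∀ i : {i : Fin n // i ∉ j.1.1}, |y i.1 - x i.1 - (j.2 i : ℤ) * r| < δ := by
  rw [cubeFaceNhd, Metric.mem_thickening_iff]
  constructor
  · rintro ⟨z, ⟨hz1, hz2⟩, hd⟩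
    have hc : ∀ i, |y i - z i| < δ := fun i => (dist_le_pi_dist y z i).trans_lt hd
    refine ⟨fun i hi => ?_, fun i => ?_⟩
    · have h1 := abs_lt.1 (hc i)
      have h2 := hz1 i hi
      rw [abs_lt]
      constructor <;> linarith [h2.1, h2.2]
    · have := hc i
      rw [hz2 i] at this
      rwa [sub_sub]
  · rintro ⟨h1, h2⟩
    refine ⟨fun i => if h : i ∈ j.1.1 then max (x i - r) (min (x i + r) (y i)) else
      x i + ((j.2 ⟨i, h⟩ : ℤ) : ℝ) * r, ⟨fun i hi => ?_, fun i => ?_⟩, ?_⟩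
    · simp only [hi, dif_pos]
      exact ⟨le_max_left _ _, max_le (by linarith) (min_le_left _ _)⟩
    · simp [i.2]
    · refine (dist_pi_lt_iff hδ).2 fun i => ?_
      rw [Real.dist_eq]
      by_cases hi : i ∈ j.1.1
      · have := abs_lt.1 (h1 i hi)
        simp only [hi, dif_pos]
        rw [abs_lt]
        rcases max_cases (x i - r) (min (x i + r) (y i)) with h | h <;>
          rcases min_cases (x i + r) (y i) with h' | h' <;>
          constructor <;> linarith [this.1, this.2]
      · have := h2 ⟨i, hi⟩
        simp only [hi, dif_neg, not_false_iff]
        rwa [← sub_sub]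

theorem volume_cubeFaceNhd {n k : ℕ} {δ r : ℝ} (hδ : 0 < δ) (hr : 0 ≤ r) (j : FaceIndex n k)
    (x : Fin n → ℝ) :
    volume (cubeFaceNhd δ j x r) =
      ENNReal.ofReal ((2 * (r + δ)) ^ k * (2 * δ) ^ (n - k)) := by
  classical
  have hbox : cubeFaceNhd δ j x r = Set.pi Set.univ (fun i =>
      Metric.ball (if h : i ∈ j.1.1 then x i else x i + ((j.2 ⟨i, h⟩ : ℤ) : ℝ) * r)
        (if i ∈ j.1.1 then r + δ else δ)) := by
    ext y
    rw [mem_cubeFaceNhd_iff hδ hr]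
    simp only [Set.mem_pi, Set.mem_univ, true_imp_iff, Metric.mem_ball, Real.dist_eq]
    constructor
    · rintro ⟨h1, h2⟩ i
      by_cases hi : i ∈ j.1.1
      · simpa [hi] using h1 i hi
      · simpa [hi, sub_sub] using h2 ⟨i, hi⟩
    · intro h
      refine ⟨fun i hi => by simpa [hi] using h i, fun i => ?_⟩
      simpa [i.2, sub_sub] using h i.1
  rw [hbox, volume_pi_pi]
  simp only [Real.volume_ball]
  rw [← ENNReal.ofReal_prod_of_nonneg (fun i _ => by split_ifs <;> positivity)]
  congr 1
  simp only [mul_ite]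
  rw [Finset.prod_ite, Finset.prod_const, Finset.prod_const]
  congr 2
  · rw [Finset.filter_mem_eq_inter, Finset.univ_inter, j.1.2]
  · have : Finset.univ.filter (fun i => i ∉ j.1.1) = (j.1.1)ᶜ := by ext; simp
    rw [this, Finset.card_compl, j.1.2, Fintype.card_fin]

/-- The neighbourhood is an increasing union of boxes shrunk by `1 / (m + 1)`, and a shrunk box
stays inside the neighbourhood when `x` moves by less than that. This yields measurability of the
maximal function although the radius functions are arbitrary. -/
theorem lowerSemicontinuous_lintegral_cubeFaceNhd {n k : ℕ} {δ r : ℝ} (hδ : 0 < δ) (hr : 0 ≤ r)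
    (j : FaceIndex n k) (g : (Fin n → ℝ) → ℝ≥0∞) :
    LowerSemicontinuous fun x => ∫⁻ y in cubeFaceNhd δ j x r, g y := by
  intro x c hc
  let E : ℕ → Set (Fin n → ℝ) := fun m => {y |
    (∀ i ∈ j.1.1, |y i - x i| < r + (δ - 1 / ((m : ℝ) + 1))) ∧
      ∀ i : {i : Fin n // i ∉ j.1.1},
        |y i.1 - x i.1 - (j.2 i : ℤ) * r| < δ - 1 / ((m : ℝ) + 1)}
  have hEmeas : ∀ m, MeasurableSet (E m) := by
    intro m
    refine IsOpen.measurableSet ?_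
    have hEm : E m = (⋂ i ∈ j.1.1, {y | |y i - x i| < r + (δ - 1 / ((m : ℝ) + 1))}) ∩
        ⋂ i : {i : Fin n // i ∉ j.1.1},
          {y | |y i.1 - x i.1 - (j.2 i : ℤ) * r| < δ - 1 / ((m : ℝ) + 1)} := by
      ext y
      simp [E]
    rw [hEm]
    exact (isOpen_biInter_finset fun i _ => isOpen_lt (by fun_prop) continuous_const).inter
      (isOpen_iInter_of_finite fun i => isOpen_lt (by fun_prop) continuous_const)
  have hmono : Monotone E := by
    intro a b hab y hy
    have : 1 / ((b : ℝ) + 1) ≤ 1 / ((a : ℝ) + 1) := by gcongr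
    exact ⟨fun i hi => (hy.1 i hi).trans_le (by linarith),
      fun i => (hy.2 i).trans_le (by linarith)⟩
  have hunion : cubeFaceNhd δ j x r = ⋃ m, E m := by
    ext y
    rw [mem_cubeFaceNhd_iff hδ hr, Set.mem_iUnion]
    constructor
    · rintro ⟨h1, h2⟩
      have hlim : Filter.Tendsto (fun m : ℕ => δ - 1 / ((m : ℝ) + 1)) Filter.atTop
          (nhds (δ - 0)) := tendsto_const_nhds.sub tendsto_one_div_add_atTop_nhds_zero_nat
      rw [sub_zero] at hlim
      have e1 : ∀ᶠ m : ℕ in Filter.atTop, ∀ i : Fin n, i ∈ j.1.1 →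
          |y i - x i| < r + (δ - 1 / ((m : ℝ) + 1)) := by
        refine Filter.eventually_all.2 fun i => ?_
        by_cases hi : i ∈ j.1.1
        · filter_upwards [(hlim.const_add r).eventually_const_lt (h1 i hi)] with m hm _ using hm
        · exact Filter.Eventually.of_forall fun _ h => absurd h hi
      have e2 : ∀ᶠ m : ℕ in Filter.atTop, ∀ i : {i : Fin n // i ∉ j.1.1},
          |y i.1 - x i.1 - (j.2 i : ℤ) * r| < δ - 1 / ((m : ℝ) + 1) :=
        Filter.eventually_all.2 fun i => hlim.eventually_const_lt (h2 i)
      exact (e1.and e2).exists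
    · rintro ⟨m, h1, h2⟩
      have : 0 < 1 / ((m : ℝ) + 1) := by positivity
      exact ⟨fun i hi => (h1 i hi).trans (by linarith), fun i => (h2 i).trans (by linarith)⟩
  have hsup : ∫⁻ y in cubeFaceNhd δ j x r, g y = ⨆ m, ∫⁻ y in E m, g y := by
    rw [hunion]
    exact setLIntegral_iUnion_of_directed g hmono.directed_le
  simp only [hsup] at hc
  obtain ⟨m, hm⟩ := lt_iSup_iff.1 hc
  filter_upwards [Metric.ball_mem_nhds x (ε := 1 / ((m : ℝ) + 1)) (by positivity)] with x' hx'
  refine hm.trans_le (lintegral_mono_set fun y hy => ?_)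
  rw [mem_cubeFaceNhd_iff hδ hr]
  have hd : ∀ i, |x' i - x i| < 1 / ((m : ℝ) + 1) := fun i =>
    (dist_le_pi_dist x' x i).trans_lt hx'
  refine ⟨fun i hi => ?_, fun i => ?_⟩
  · have h1 := abs_lt.1 (hy.1 i hi)
    have h2 := abs_lt.1 (hd i)
    rw [abs_lt]
    constructor <;> linarith [h1.1, h1.2, h2.1, h2.2]
  · have h1 := abs_lt.1 (hy.2 i)
    have h2 := abs_lt.1 (hd i)
    rw [abs_lt]
    constructor <;> linarith [h1.1, h1.2, h2.1, h2.2]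

theorem nonempty_faceIndex {n k : ℕ} (hkn : k ≤ n) : Nonempty (FaceIndex n k) := by
  obtain ⟨t, -, ht⟩ := Finset.exists_subset_card_eq
    (s := (Finset.univ : Finset (Fin n))) (n := k) (by simpa using hkn)
  exact ⟨⟨⟨t, ht⟩, fun _ => 1⟩⟩

theorem skeletonMaximal_eq_iSup {n : ℕ} {𝕜 : Type*} [RCLike 𝕜] (k : ℕ) (δ : ℝ)
    (f : (Fin n → ℝ) → 𝕜) (x : Fin n → ℝ) :
    skeletonMaximal k δ f x =
      ⨆ r : Set.Ioc δ 2, ⨅ j : FaceIndex n k, faceAverage δ f j x r := by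
  refine le_antisymm (iSup_le fun r => le_iSup_of_le (r x) le_rfl) (iSup_le fun r => ?_)
  exact le_iSup_of_le (fun _ => r) le_rfl

theorem lowerSemicontinuous_skeletonMaximal {n k : ℕ} (hkn : k ≤ n) {𝕜 : Type*} [RCLike 𝕜]
    {δ : ℝ} (hδ : 0 < δ) (f : (Fin n → ℝ) → 𝕜) :
    LowerSemicontinuous (skeletonMaximal k δ f) := by
  classical
  have := nonempty_faceIndex hkn
  have he : skeletonMaximal k δ f =
      fun x => ⨆ r : Set.Ioc δ 2, ⨅ j : FaceIndex n k, faceAverage δ f j x r :=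
    funext (skeletonMaximal_eq_iSup k δ f)
  rw [he]
  refine lowerSemicontinuous_iSup fun r => ?_
  have hr : (0 : ℝ) ≤ r := hδ.le.trans r.2.1.le
  have hj : ∀ j : FaceIndex n k, LowerSemicontinuous fun x => faceAverage δ f j x r := by
    intro j
    simp only [faceAverage, volume_cubeFaceNhd hδ hr]
    refine (ENNReal.continuous_const_mul ?_).comp_lowerSemicontinuous
      (lowerSemicontinuous_lintegral_cubeFaceNhd hδ hr j _) (fun a b hab => mul_le_mul' le_rfl hab)
    have h : 0 < r + δ := by linarith
    exact ENNReal.inv_ne_top.2 (ENNReal.ofReal_pos.2 (by positivity)).ne'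
  intro x c hc
  have hc' : ∀ j : FaceIndex n k, c < faceAverage δ f j x r := fun j => hc.trans_le (iInf_le _ j)
  filter_upwards [Filter.eventually_all.2 fun j => hj j x c (hc' j)] with x' hx'
  obtain ⟨j₀, h₀⟩ := exists_eq_ciInf_of_finite (f := fun j : FaceIndex n k =>
    faceAverage δ f j x' r)
  rw [← h₀]
  exact hx' j₀

/-! ### Jensen and discretisation at scale `δ` -/

theorem rpow_mean_le {α 𝕜 : Type*} [MeasurableSpace α] [RCLike 𝕜] {μ : Measure α} {E : Set α}
    (h0 : μ E ≠ 0) (htop : μ E ≠ ∞) {f : α → 𝕜} (hf : AEStronglyMeasurable f μ) {p : ℝ}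
    (hp : 1 ≤ p) :
    ((μ E)⁻¹ * ∫⁻ y in E, ‖f y‖ₑ ∂μ) ^ p ≤ (μ E)⁻¹ * ∫⁻ y in E, ‖f y‖ₑ ^ p ∂μ := by
  have hprob : IsProbabilityMeasure ((μ E)⁻¹ • μ.restrict E) :=
    ⟨by simp [ENNReal.inv_mul_cancel h0 htop]⟩
  have h := eLpNorm'_le_eLpNorm'_of_exponent_le (p := 1) (q := p) one_pos hp
    ((μ E)⁻¹ • μ.restrict E) (f := f)
    (hf.restrict.mono_ac (Measure.smul_absolutelyContinuous))
  simp only [eLpNorm', lintegral_smul_measure, ENNReal.rpow_one, div_one, smul_eq_mul] at h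
  have hp0 : 0 < p := by linarith
  calc _ ≤ (((μ E)⁻¹ * ∫⁻ y in E, ‖f y‖ₑ ^ p ∂μ) ^ (1 / p)) ^ p := by gcongr
    _ = _ := by rw [← ENNReal.rpow_mul, one_div_mul_cancel hp0.ne', ENNReal.rpow_one]

/-- The index of the half-open cell of the lattice `δ ℤⁿ` that contains `x`. -/
noncomputable def latticeCell {n : ℕ} (δ : ℝ) (x : Fin n → ℝ) : Fin n → ℤ := fun i => ⌊x i / δ⌋

theorem measurable_latticeCell {n : ℕ} (δ : ℝ) :
    Measurable (latticeCell δ : (Fin n → ℝ) → Fin n → ℤ) :=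
  measurable_pi_lambda _ fun i => Int.measurable_floor.comp (by fun_prop)

theorem volume_latticeCell_preimage {n : ℕ} {δ : ℝ} (hδ : 0 < δ) (z : Fin n → ℤ) :
    volume (latticeCell δ ⁻¹' {z}) = ENNReal.ofReal (δ ^ n) := by
  have : latticeCell δ ⁻¹' {z} =
      Set.pi Set.univ (fun i => Set.Ico ((z i : ℝ) * δ) ((z i + 1) * δ)) := by
    ext x
    simp only [Set.mem_preimage, Set.mem_singleton_iff, latticeCell, funext_iff, Int.floor_eq_iff,
      Set.mem_pi, Set.mem_univ, true_imp_iff, Set.mem_Ico, le_div_iff₀ hδ, div_lt_iff₀ hδ]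
  rw [this, volume_pi_pi]
  have e : ∀ i, ((z i : ℝ) + 1) * δ - z i * δ = δ := fun i => by ring
  simp only [Real.volume_Ico, e, Finset.prod_const, Finset.card_univ, Fintype.card_fin]
  rw [ENNReal.ofReal_pow hδ.le]

/-- The tolerance `3` is the rescaled width `1`, plus less than `1` from rounding `x` and `y`, plus
less than `1` from rounding `r`. -/
theorem nearLatticeFace_of_mem_cubeFaceNhd {n k : ℕ} {δ r : ℝ} (hδ : 0 < δ) (hr : 0 ≤ r)
    (j : FaceIndex n k) {x y : Fin n → ℝ} (hy : y ∈ cubeFaceNhd δ j x r) :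
    NearLatticeFace j (latticeCell δ x) (⌊r / δ⌋₊ : ℤ) (latticeCell δ y) := by
  rw [mem_cubeFaceNhd_iff hδ hr] at hy
  have hs1 : ((⌊r / δ⌋₊ : ℕ) : ℝ) ≤ r / δ := Nat.floor_le (by positivity)
  have hs2 : r / δ < (⌊r / δ⌋₊ : ℕ) + 1 := Nat.lt_floor_add_one _
  have hfl : ∀ (u : Fin n → ℝ) i, (latticeCell δ u i : ℝ) ≤ u i / δ ∧
      u i / δ < latticeCell δ u i + 1 := fun u i => ⟨Int.floor_le _, Int.lt_floor_add_one _⟩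
  refine ⟨fun i hi => ?_, fun i => ?_⟩
  · have h := hy.1 i hi
    have h' : |y i / δ - x i / δ| < r / δ + 1 := by
      rw [← sub_div, abs_div, abs_of_pos hδ, div_lt_iff₀ hδ, add_mul, div_mul_cancel₀ _ hδ.ne']
      linarith
    have h1 := hfl x i
    have h2 := hfl y i
    have h3 := abs_lt.1 h'
    suffices H : |(latticeCell δ y i : ℝ) - latticeCell δ x i| ≤ (⌊r / δ⌋₊ : ℕ) + 3 by
      exact_mod_cast H
    rw [abs_le]
    constructor <;> linarith [h1.1, h1.2, h2.1, h2.2, h3.1, h3.2]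
  · have h := hy.2 i
    have h' : |y i / δ - x i / δ - (j.2 i : ℤ) * (r / δ)| < 1 := by
      rw [← mul_div_assoc, ← sub_div, ← sub_div, abs_div, abs_of_pos hδ, div_lt_iff₀ hδ, one_mul]
      exact h
    have h1 := hfl x i
    have h2 := hfl y i
    have h3 := abs_lt.1 h'
    suffices H : |(latticeCell δ y i : ℝ) - latticeCell δ x i -
        ((j.2 i : ℤ) : ℝ) * (⌊r / δ⌋₊ : ℕ)| ≤ 3 by
      exact_mod_cast H
    rw [abs_le]
    rcases Int.units_eq_one_or (j.2 i) with hu | hu <;> rw [hu] at h3 ⊢ <;>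
      push_cast [Units.val_one, Units.val_neg] at h3 ⊢ <;>
      constructor <;> linarith [h1.1, h1.2, h2.1, h2.2, h3.1, h3.2]

theorem tsum_setLIntegral_le_of_card_le {α ι : Type*} [Countable ι] [MeasurableSpace α]
    {μ : Measure α} {D : ι → Set α} (hD : ∀ z, MeasurableSet (D z)) {g : α → ℝ≥0∞}
    (hg : AEMeasurable g μ) {K : ℝ}
    (h : ∀ y, ∃ A : Finset ι, (∀ z, y ∈ D z → z ∈ A) ∧ (A.card : ℝ) ≤ K) :
    ∑' z, ∫⁻ y in D z, g y ∂μ ≤ ENNReal.ofReal K * ∫⁻ y, g y ∂μ := by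
  simp only [← lintegral_indicator (hD _)]
  rw [← lintegral_tsum fun z => hg.indicator (hD z), ← lintegral_const_mul'' _ hg]
  refine lintegral_mono fun y => ?_
  obtain ⟨A, hA, hcard⟩ := h y
  simp only
  rw [tsum_eq_sum (s := A) fun z hz => Set.indicator_of_notMem (fun hy => hz (hA z hy)) _]
  calc ∑ z ∈ A, (D z).indicator g y ≤ ∑ _z ∈ A, g y :=
        Finset.sum_le_sum fun z _ => Set.indicator_le_self _ _ _
    _ = ENNReal.ofReal A.card * g y := by simp
    _ ≤ _ := by gcongr

/-- The mean of `g` over the lattice cells near the `k`-face `j` of the integer cube with centre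
`z` and radius `s`, with a normalisation comparable to the volume of these cells. -/
noncomputable def latticeFaceMean {n k : ℕ} (δ : ℝ) (g : (Fin n → ℝ) → ℝ≥0∞)
    (j : FaceIndex n k) (z : Fin n → ℤ) (s : ℕ) : ℝ≥0∞ :=
  (ENNReal.ofReal (δ ^ n * (s : ℝ) ^ k))⁻¹ *
    ∫⁻ y in {y | NearLatticeFace j z s (latticeCell δ y)}, g y

theorem rpow_faceAverage_le_latticeFaceMean {n k : ℕ} (hkn : k ≤ n) {𝕜 : Type*} [RCLike 𝕜]
    {δ r : ℝ} (hδ : 0 < δ) (hr : δ ≤ r) {f : (Fin n → ℝ) → 𝕜} (hf : AEStronglyMeasurable f volume)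
    {p : ℝ} (hp : 1 ≤ p) (j : FaceIndex n k) (x : Fin n → ℝ) :
    faceAverage δ f j x r ^ p ≤
      latticeFaceMean δ (fun y => ‖f y‖ₑ ^ p) j (latticeCell δ x) ⌊r / δ⌋₊ := by
  have hr0 : 0 ≤ r := hδ.le.trans hr
  have hvol := volume_cubeFaceNhd hδ hr0 j x
  have hpos : 0 < r + δ := by linarith
  have h0 : volume (cubeFaceNhd δ j x r) ≠ 0 := by
    rw [hvol]; exact (ENNReal.ofReal_pos.2 (by positivity)).ne'
  have htop : volume (cubeFaceNhd δ j x r) ≠ ∞ := by rw [hvol]; exact ENNReal.ofReal_ne_top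
  refine (rpow_mean_le h0 htop hf hp).trans ?_
  rw [latticeFaceMean, hvol]
  refine mul_le_mul' (ENNReal.inv_le_inv.2 (ENNReal.ofReal_le_ofReal ?_))
    (lintegral_mono_set fun y hy => nearLatticeFace_of_mem_cubeFaceNhd hδ hr0 j hy)
  have hs : ((⌊r / δ⌋₊ : ℕ) : ℝ) * δ ≤ r := by
    rw [← le_div_iff₀ hδ]; exact Nat.floor_le (by positivity)
  obtain ⟨d, rfl⟩ := Nat.exists_eq_add_of_le hkn
  calc δ ^ (k + d) * ((⌊r / δ⌋₊ : ℕ) : ℝ) ^ k = (((⌊r / δ⌋₊ : ℕ) : ℝ) * δ) ^ k * δ ^ d := by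
        ring
    _ ≤ (2 * (r + δ)) ^ k * (2 * δ) ^ (k + d - k) := by
        rw [Nat.add_sub_cancel_left]
        exact mul_le_mul (pow_le_pow_left₀ (by positivity) (by linarith) _)
          (pow_le_pow_left₀ hδ.le (by linarith) _) (by positivity) (by positivity)

/-- Bound the infimum by the assigned face and use bounded overlap; the normalisation `S ^ k`
cancels all but the excess power of the overlap. -/
theorem tsum_iInf_latticeFaceMean_le {n k : ℕ} (hkn : k < n) {δ : ℝ} (hδ : 0 < δ)
    {g : (Fin n → ℝ) → ℝ≥0∞} (hg : AEMeasurable g volume) (S : ℕ) (hS : 0 < S)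
    (s : (Fin n → ℤ) → ℕ) (hs : ∀ z, S ≤ s z ∧ s z ≤ 2 * S) :
    ENNReal.ofReal (δ ^ n) * ∑' z, ⨅ j : FaceIndex n k, latticeFaceMean δ g j z (s z) ≤
      ENNReal.ofReal ((11 ^ n * 7 ^ n * n.choose k * 4) *
        (S : ℝ) ^ (((n : ℝ) - k) / (2 * n))) * ∫⁻ y, g y := by
  obtain ⟨j, hj⟩ := exists_face_assignment (k := k) hkn S hS (fun z => (s z : ℤ))
    (fun z => by exact_mod_cast hs z)
  have hS0 : (0 : ℝ) < S := by exact_mod_cast hS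
  calc _ ≤ ENNReal.ofReal (δ ^ n) * ∑' z, (ENNReal.ofReal (δ ^ n * (S : ℝ) ^ k))⁻¹ *
        ∫⁻ y in {y | NearLatticeFace (j z) z (s z) (latticeCell δ y)}, g y := by
        gcongr with z
        refine (iInf_le _ (j z)).trans ?_
        rw [latticeFaceMean]
        gcongr
        exact (hs z).1
    _ ≤ ENNReal.ofReal (δ ^ n) * ((ENNReal.ofReal (δ ^ n * (S : ℝ) ^ k))⁻¹ *
        (ENNReal.ofReal ((11 ^ n * 7 ^ n * n.choose k * 4) *
          (S : ℝ) ^ ((k : ℝ) + ((n : ℝ) - k) / (2 * n))) * ∫⁻ y, g y)) := by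
        rw [ENNReal.tsum_mul_left]
        gcongr
        exact tsum_setLIntegral_le_of_card_le
          (fun z => measurable_latticeCell δ (MeasurableSet.of_discrete
            (s := {w | NearLatticeFace (j z) z (s z) w}))) hg
          (fun y => hj (latticeCell δ y))
    _ = _ := by
        rw [← ENNReal.ofReal_inv_of_pos (by positivity), ← mul_assoc, ← mul_assoc,
          ← ENNReal.ofReal_mul (by positivity), ← ENNReal.ofReal_mul (by positivity)]
        congr 2
        rw [Real.rpow_add hS0, Real.rpow_natCast]
        field_simp

/-! ### Summation over dyadic radii and conclusion -/

theorem sum_two_pow_rpow_le {α : ℝ} (hα : 0 < α) {L : ℝ} (hL : 1 ≤ L) :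
    ∑ m ∈ Finset.range (Nat.log 2 ⌊L⌋₊ + 1), (((2 ^ m : ℕ) : ℝ)) ^ α ≤
      2 ^ α / (2 ^ α - 1) * L ^ α := by
  have h2 : 1 < (2 : ℝ) ^ α := Real.one_lt_rpow (by norm_num) hα
  have hL0 : ⌊L⌋₊ ≠ 0 := (Nat.floor_pos.2 hL).ne'
  have e : ∀ m : ℕ, (((2 ^ m : ℕ) : ℝ)) ^ α = ((2 : ℝ) ^ α) ^ m := by
    intro m
    push_cast
    rw [← Real.rpow_natCast, ← Real.rpow_natCast, ← Real.rpow_mul (by norm_num),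
      ← Real.rpow_mul (by norm_num), mul_comm]
  have hM : ((2 : ℝ) ^ α) ^ (Nat.log 2 ⌊L⌋₊) ≤ L ^ α := by
    rw [← e]
    gcongr
    exact (Nat.cast_le.2 (Nat.pow_log_le_self 2 hL0)).trans (Nat.floor_le (by linarith))
  simp only [e]
  rw [geom_sum_eq h2.ne', pow_succ, div_mul_eq_mul_div]
  have : 0 < (2 : ℝ) ^ α - 1 := by linarith
  gcongr
  nlinarith

theorem lintegral_rpow_skeletonMaximal_le {n k : ℕ} (hkn : k < n) {𝕜 : Type*} [RCLike 𝕜]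
    {δ : ℝ} (hδ : 0 < δ) (hδ1 : δ < 1) {f : (Fin n → ℝ) → 𝕜}
    (hf : AEStronglyMeasurable f volume) {p : ℝ} (hp : 1 ≤ p) {α : ℝ}
    (hα : α = ((n : ℝ) - k) / (2 * n)) :
    ∫⁻ x, skeletonMaximal k δ f x ^ p ≤
      ENNReal.ofReal ((11 ^ n * 7 ^ n * n.choose k * 4) *
        (2 ^ α / (2 ^ α - 1) * (2 / δ) ^ α)) * ∫⁻ y, ‖f y‖ₑ ^ p := by
  have hp0 : 0 < p := by linarith
  have hn0 : (0 : ℝ) < n := by exact_mod_cast (by omega : 0 < n)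
  have hα0 : 0 < α := by
    rw [hα]
    have : (k : ℝ) < n := by exact_mod_cast hkn
    exact div_pos (by linarith) (by linarith)
  set g : (Fin n → ℝ) → ℝ≥0∞ := fun y => ‖f y‖ₑ ^ p with hg
  have hgm : AEMeasurable g volume := hf.enorm.pow_const p
  let B : (Fin n → ℤ) → ℕ → ℝ≥0∞ := fun z s => ⨅ j : FaceIndex n k, latticeFaceMean δ g j z s
  -- The worst radius may depend on the cell arbitrarily, since the face assignment works for any
  -- radius function in a dyadic range.
  have hmax : ∀ (m : ℕ) (z : Fin n → ℤ), ∃ s ∈ Finset.Ico (2 ^ m) (2 ^ (m + 1)),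
      ∀ s' ∈ Finset.Ico (2 ^ m) (2 ^ (m + 1)), B z s' ≤ B z s := fun m z =>
    Finset.exists_max_image _ _ ⟨2 ^ m, Finset.mem_Ico.2
      ⟨le_rfl, Nat.pow_lt_pow_right (by norm_num) (Nat.lt_succ_self m)⟩⟩
  choose s hs hsmax using hmax
  set M := Nat.log 2 ⌊2 / δ⌋₊ + 1
  let H : (Fin n → ℤ) → ℝ≥0∞ := fun z => ∑ m ∈ Finset.range M, B z (s m z)
  have hle : ∀ x, skeletonMaximal k δ f x ^ p ≤ H (latticeCell δ x) := by
    intro x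
    rw [← ENNReal.le_rpow_inv_iff hp0, skeletonMaximal_eq_iSup]
    refine iSup_le fun r => ?_
    rw [ENNReal.le_rpow_inv_iff hp0]
    have hr1 : 1 ≤ (r : ℝ) / δ := (one_le_div hδ).2 r.2.1.le
    have hfl : ⌊(r : ℝ) / δ⌋₊ ≠ 0 := (Nat.floor_pos.2 hr1).ne'
    set t := ⌊(r : ℝ) / δ⌋₊
    have htm : t ∈ Finset.Ico (2 ^ Nat.log 2 t) (2 ^ (Nat.log 2 t + 1)) :=
      Finset.mem_Ico.2 ⟨Nat.pow_log_le_self 2 hfl, Nat.lt_pow_succ_log_self (by norm_num) t⟩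
    have htM : Nat.log 2 t ∈ Finset.range M := by
      refine Finset.mem_range.2 (Nat.lt_succ_of_le (Nat.log_mono_right (Nat.floor_mono ?_)))
      have := r.2.2
      gcongr
    calc (⨅ j : FaceIndex n k, faceAverage δ f j x r) ^ p ≤ B (latticeCell δ x) t := by
          refine le_iInf fun j => ?_
          refine le_trans ?_ (rpow_faceAverage_le_latticeFaceMean hkn.le hδ r.2.1.le hf hp j x)
          exact ENNReal.rpow_le_rpow (iInf_le _ j) hp0.le
      _ ≤ B (latticeCell δ x) (s (Nat.log 2 t) (latticeCell δ x)) := hsmax _ _ t htm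
      _ ≤ H (latticeCell δ x) := Finset.single_le_sum
          (f := fun m => B (latticeCell δ x) (s m (latticeCell δ x))) (fun _ _ => zero_le) htM
  calc ∫⁻ x, skeletonMaximal k δ f x ^ p ≤ ∫⁻ x, H (latticeCell δ x) :=
        lintegral_mono hle
    _ = ∑' z, H z * ENNReal.ofReal (δ ^ n) := by
        rw [← lintegral_map (μ := volume) (f := H) (Measurable.of_discrete)
          (measurable_latticeCell δ), lintegral_countable']
        refine tsum_congr fun z => ?_
        rw [Measure.map_apply (measurable_latticeCell δ) (measurableSet_singleton z),
          volume_latticeCell_preimage hδ]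
    _ = ∑ m ∈ Finset.range M, ENNReal.ofReal (δ ^ n) * ∑' z, B z (s m z) := by
        rw [ENNReal.tsum_mul_right, mul_comm, ← Finset.mul_sum,
          Summable.tsum_finsetSum fun _ _ => ENNReal.summable]
    _ ≤ ∑ m ∈ Finset.range M, ENNReal.ofReal ((11 ^ n * 7 ^ n * n.choose k * 4) *
        (((2 ^ m : ℕ) : ℝ)) ^ α) * ∫⁻ y, g y := by
        refine Finset.sum_le_sum fun m _ => ?_
        rw [hα]
        refine tsum_iInf_latticeFaceMean_le hkn hδ hgm (2 ^ m) (by positivity) (s m)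
          fun z => ?_
        have := Finset.mem_Ico.1 (hs m z)
        rw [pow_succ] at this
        omega
    _ ≤ _ := by
        rw [← Finset.sum_mul, ← ENNReal.ofReal_sum_of_nonneg fun _ _ => by positivity,
          ← Finset.mul_sum]
        gcongr
        refine sum_two_pow_rpow_le hα0 ?_
        rw [one_le_div hδ]; linarith

theorem theorem2 (n k : ℕ) (hkn : k < n) :
    ∃ C : ℝ, 0 < C ∧
      ∀ (𝕜 : Type) [RCLike 𝕜] (p : ℝ), 1 ≤ p → ∀ δ : ℝ, 0 < δ → δ < 1 →
        ∀ f : (Fin n → ℝ) → 𝕜, MemLp f (ENNReal.ofReal p) volume →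
          MemLp (skeletonMaximal k δ f) (ENNReal.ofReal p) volume ∧
          eLpNorm (skeletonMaximal k δ f) (ENNReal.ofReal p) volume ≤
            ENNReal.ofReal (C * δ ^ (((k : ℝ) - n) / (2 * n * p))) *
              eLpNorm f (ENNReal.ofReal p) volume := by
  obtain ⟨α, hα⟩ : ∃ α : ℝ, α = ((n : ℝ) - k) / (2 * n) := ⟨_, rfl⟩
  set C₀ : ℝ := (11 ^ n * 7 ^ n * n.choose k * 4) * (2 ^ α / (2 ^ α - 1) * 2 ^ α) with hC₀
  -- With `C ≥ 1` one has `C₀ ≤ C ≤ C ^ p`, so `C` is independent of `p`.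
  refine ⟨max 1 C₀, by positivity, ?_⟩
  intro 𝕜 _ p hp δ hδ hδ1 f hf
  have hp0 : 0 < p := by linarith
  have hn0 : (0 : ℝ) < n := by exact_mod_cast (by omega : 0 < n)
  have key := lintegral_rpow_skeletonMaximal_le hkn hδ hδ1 hf.1 hp hα
  have hnorm : eLpNorm (skeletonMaximal k δ f) (ENNReal.ofReal p) volume ≤
      ENNReal.ofReal (max 1 C₀ * δ ^ (((k : ℝ) - n) / (2 * n * p))) *
        eLpNorm f (ENNReal.ofReal p) volume := by
    have h0 : ENNReal.ofReal p ≠ 0 := (ENNReal.ofReal_pos.2 hp0).ne'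
    rw [eLpNorm_eq_lintegral_rpow_enorm_toReal h0 ENNReal.ofReal_ne_top,
      eLpNorm_eq_lintegral_rpow_enorm_toReal h0 ENNReal.ofReal_ne_top,
      ENNReal.toReal_ofReal hp0.le]
    simp only [enorm_eq_self]
    have hreal : (11 ^ n * 7 ^ n * n.choose k * 4) * (2 ^ α / (2 ^ α - 1) * (2 / δ) ^ α) ≤
        (max 1 C₀ * δ ^ (((k : ℝ) - n) / (2 * n * p))) ^ p := by
      have h1 : (11 ^ n * 7 ^ n * n.choose k * 4) * (2 ^ α / (2 ^ α - 1) * (2 / δ) ^ α) =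
          C₀ * δ ^ (-α) := by
        rw [hC₀, Real.div_rpow (by norm_num) hδ.le, Real.rpow_neg hδ.le]
        ring
      rw [h1, Real.mul_rpow (by positivity) (by positivity), ← Real.rpow_mul hδ.le]
      have h2 : ((k : ℝ) - n) / (2 * n * p) * p = -α := by
        rw [hα]; field_simp; ring
      rw [h2]
      gcongr
      calc C₀ ≤ max 1 C₀ := le_max_right _ _
        _ = max 1 C₀ ^ (1 : ℝ) := (Real.rpow_one _).symm
        _ ≤ max 1 C₀ ^ p := Real.rpow_le_rpow_of_exponent_le (le_max_left _ _) hp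
    calc (∫⁻ x, skeletonMaximal k δ f x ^ p) ^ (1 / p)
        ≤ (ENNReal.ofReal ((max 1 C₀ * δ ^ (((k : ℝ) - n) / (2 * n * p))) ^ p) *
          ∫⁻ y, ‖f y‖ₑ ^ p) ^ (1 / p) := by
          refine ENNReal.rpow_le_rpow (key.trans ?_) (by positivity)
          gcongr
      _ = _ := by
          rw [ENNReal.mul_rpow_of_nonneg _ _ (by positivity),
            ← ENNReal.ofReal_rpow_of_nonneg (by positivity) hp0.le, ← ENNReal.rpow_mul,
            mul_one_div_cancel hp0.ne', ENNReal.rpow_one]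
  refine ⟨⟨(lowerSemicontinuous_skeletonMaximal hkn.le hδ f).measurable.aestronglyMeasurable,
    hnorm.trans_lt ?_⟩, hnorm⟩
  exact ENNReal.mul_lt_top ENNReal.ofReal_lt_top hf.2
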